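/- **Concentration under changing regularizers.** *Model.* Let $(\mathcal S,\mathcal A,H,(\mathbb P_h)_{h\in[H]},(R_h)_{h\in[H]})$ be an episodic MDP on measurable spaces $\mathcal S,\mathcal A$, where $\mathbb P_h(\cdot\mid s,a)$ is the transition probability and $R_h(\cdot\mid s,a)$, supported on $[0,1]$, is the distribution of the random reward at step $h$, with mean $r_h(s,a)$. Assume that it is a linear mixture MDP: for a $\sigma$-finite reference measure $ds'$ on $\mathcal S$, measurable feature maps $\psi:\mathcal S\times\mathcal A\times\mathcal S\to\mathbb R^{d_1}$ with $\psi(s,a,\cdot)$ integrable and $\varphi:\mathcal S\times\mathcal A\to\mathbb R^{d_2}$, and vectors $\theta_{h,p}\in\mathbb R^{d_1}$, $\theta_{h,r}\in\mathbb R^{d_2}$ with $\|\theta_{h,p}\|_2\le\sqrt{d_1}$, $\|\theta_{h,r}\|_2\le\sqrt{d_2}$, $$\mathbb P_h(ds'\mid s,a)=\langle\psi(s,a,s'),\theta_{h,p}\rangle\,ds',\qquad \langle\psi(s,a,s'),\theta_{h,p}\rangle\ge 0,\qquad r_h(s,a)=\langle\varphi(s,a),\theta_{h,r}\rangle$$ for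 all $h,s,a,s'$; moreover $\|\varphi(s,a)\|_2\le1$ and $\bigl\|\int\psi(s,a,s')V(s')\,ds'\bigr\|_2\le\sqrt{d_1}\,H$ for all $s,a$ and all measurable $V:\mathcal S\to[0,H]$. *Interaction.* For episodes $k=1,\dots,K$ a trajectory $s_1^k,a_1^k,r_1^k,\dots,s_H^k,a_H^k,r_H^k,s_{H+1}^k$ is observed on a probability space: let $\mathcal G_{k}$ be the $\sigma$-algebra generated by the trajectories of episodes $1,\dots,k-1$ together with any additional information (internal randomization, regularizers) that the agent has before episode $k$, this additional information being non-decreasing in $k$; let $\mathcal G_{k,h}$ be generated by $\mathcal G_k$ and $s_1^k,a_1^k,r_1^k,\dots,r_{h-1}^k,s_h^k,a_h^k$. Given $\mathcal G_{k,h}$, the reward $r_h^k$ has law $R_h(\cdot\mid s_h^k,a_h^k)$ and $s_{h+1}^k$ has law $\mathbb P_h(\cdot\mid s_h^k,a_h^k)$. Actions may be chosen in any way, and the initial states are arbitrary. The agent maintains random functions $V_h^k:\mathcal S\to[0,H]$, $h\in[H+1]$, that are $\mathcal G_k$-measurable (jointly measurable in outcome and state). Put $\phi_h^k(s,a)=\int\psi(s,a,s')V_{h+1}^k(s')\,ds'$.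 *Estimators.* For random matrices $Z_{h,p}^k\in\mathbb R^{d_1\times d_1}$, $Z_{h,r}^k\in\mathbb R^{d_2\times d_2}$ and random vectors $z_{h,p}^k\in\mathbb R^{d_1}$, $z_{h,r}^k\in\mathbb R^{d_2}$ let $$\Lambda_{h,p}^k=Z_{h,p}^k+\sum_{j=1}^{k-1}\phi_h^j(s_h^j,a_h^j)\phi_h^j(s_h^j,a_h^j)^\top,\quad u_{h,p}^k=\sum_{j=1}^{k-1}\phi_h^j(s_h^j,a_h^j)V_{h+1}^j(s_{h+1}^j)+z_{h,p}^k,\quad \hat\theta_{h,p}^k=(\Lambda_{h,p}^k)^{-1}u_{h,p}^k,$$ $$\Lambda_{h,r}^k=Z_{h,r}^k+\sum_{j=1}^{k-1}\varphi(s_h^j,a_h^j)\varphi(s_h^j,a_h^j)^\top,\quad u_{h,r}^k=\sum_{j=1}^{k-1}\varphi(s_h^j,a_h^j)r_h^j+z_{h,r}^k,\quad \hat\theta_{h,r}^k=(\Lambda_{h,r}^k)^{-1}u_{h,r}^k.$$ Write $\|x\|_M=\sqrt{x^\top Mx}$, and $\|M\|$ for the spectral norm. *Regularity.* Let $\alpha\in(0,1]$,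 and let $\lambda_{\max,p},\lambda_{\max,r},\nu_p,\nu_r\in\mathbb R$ and $\lambda_{\min,p},\lambda_{\min,r}>0$ be constants (they may depend on $\alpha$) such that, with probability at least $1-\alpha$, for both $\bullet\in\{p,r\}$ and all $k\in[K]$, $h\in[H]$ simultaneously, $Z_{h,\bullet}^k$ is (symmetric) positive definite, $$\|Z_{h,\bullet}^k\|\le\lambda_{\max,\bullet},\qquad \|(Z_{h,\bullet}^k)^{-1}\|\le 1/\lambda_{\min,\bullet},\qquad \|z_{h,\bullet}^k\|_{(Z_{h,\bullet}^k)^{-1}}\le\nu_\bullet .$$ *Conclusion.* With probability at least $1-3\alpha$, simultaneously for all $k\in[K]$ and $h\in[H]$, the matrices $\Lambda_{h,p}^k$ and $\Lambda_{h,r}^k$ are positive definite and $$\|\theta_{h,p}-\hat\theta_{h,p}^k\|_{\Lambda_{h,p}^k}\le\beta_p(\alpha),\qquad \|\theta_{h,r}-\hat\theta_{h,r}^k\|_{\Lambda_{h,r}^k}\le\beta_r(\alpha),$$ where $$\beta_p(\alpha)=\frac H2\sqrt{2\ln\Bigl(\frac H\alpha\Bigr)+d_1\ln\Bigl(1+\frac{KH^2}{\lambda_{\min,p}}\Bigr)}+\sqrt{d_1\lambda_{\max,p}}+\nu_p,$$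 $$\beta_r(\alpha)=\frac12\sqrt{2\ln\Bigl(\frac H\alpha\Bigr)+d_2\ln\Bigl(1+\frac{K}{d_2\lambda_{\min,r}}\Bigr)}+\sqrt{d_2\lambda_{\max,r}}+\nu_r .$$ -/

import Mathlib

open MeasureTheory ProbabilityTheory

namespace LinMix

/-- Euclidean space `ℝ^d` with its `ℓ²` norm. -/
abbrev Vec (d : ℕ) : Type := EuclideanSpace ℝ (Fin d)

/-- The weighted (semi-)norm `‖x‖_M = √(xᵀ M x)`. -/
noncomputable def wnorm {d : ℕ} (M : Matrix (Fin d) (Fin d) ℝ) (x : Vec d) : ℝ :=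
  Real.sqrt (x.ofLp ⬝ᵥ M.mulVec x.ofLp)

/-- The spectral norm of a matrix, i.e. its operator norm on Euclidean space. -/
noncomputable def opNorm {d : ℕ} (M : Matrix (Fin d) (Fin d) ℝ) : ℝ :=
  ‖Matrix.toEuclideanCLM (n := Fin d) (𝕜 := ℝ) M‖

/-! ### Episodic Markov decision processes and the linear mixture model -/

/-- An episodic MDP with horizon `H`. Step `h` of the horizon (numbered `1, …, H` in the usual
notation) is an element of `Fin H`. -/
structure EpisodicMDP (S A : Type*) [MeasurableSpace S] [MeasurableSpace A] (H : ℕ) where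
  /-- the transition probabilities `ℙ_h(· | s, a)` -/
  trans : Fin H → Kernel (S × A) S
  /-- the distribution of the random reward at step `h` in state `s` under action `a` -/
  reward : Fin H → Kernel (S × A) ℝ
  markov_trans : ∀ h, IsMarkovKernel (trans h)
  markov_reward : ∀ h, IsMarkovKernel (reward h)
  /-- rewards are supported on `[0, 1]` -/
  reward_supp : ∀ h x, reward h x (Set.Icc 0 1)ᶜ = 0

/-- The mean reward `r_h(s, a)`. -/
noncomputable def EpisodicMDP.meanReward {S A : Type*} [MeasurableSpace S] [MeasurableSpace A]
    {H : ℕ} (M : EpisodicMDP S A H) (h : Fin H) (s : S) (a : A) : ℝ :=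
  ∫ x, x ∂(M.reward h (s, a))

/-- The feature `φ_V(s, a) = ∫ ψ(s, a, s') V(s') ds'`, where `ds'` is the reference measure `μ`. -/
noncomputable def valueFeature {S A : Type*} [MeasurableSpace S] {d : ℕ} (μ : Measure S)
    (ψ : S → A → S → Vec d) (V : S → ℝ) (s : S) (a : A) : Vec d :=
  ∫ s', V s' • ψ s a s' ∂μ

/-- The linear mixture MDP assumption: `ℙ_h(· | s, a)` has the density
`s' ↦ ⟪ψ(s, a, s'), θ_{h,p}⟫` with respect to the reference measure `μ` on the state space
(Lebesgue measure, counting measure, …), the mean reward is `⟪φ(s, a), θ_{h,r}⟫`, and the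
features and parameters obey the norm bounds. -/
structure IsLinearMixture {S A : Type*} [MeasurableSpace S] [MeasurableSpace A] {H d₁ d₂ : ℕ}
    (M : EpisodicMDP S A H) (μ : Measure S) (ψ : S → A → S → Vec d₁) (φ : S → A → Vec d₂)
    (θp : Fin H → Vec d₁) (θr : Fin H → Vec d₂) : Prop where
  measurable_ψ : Measurable fun x : S × A × S => ψ x.1 x.2.1 x.2.2
  measurable_φ : Measurable fun x : S × A => φ x.1 x.2
  /-- so that the integrals `∫ ψ(s, a, s') V(s') ds'` exist for bounded measurable `V` -/
  integrable_ψ : ∀ s a, Integrable (ψ s a) μ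
  norm_θp : ∀ h, ‖θp h‖ ≤ Real.sqrt d₁
  norm_θr : ∀ h, ‖θr h‖ ≤ Real.sqrt d₂
  density_nonneg : ∀ h s a s', 0 ≤ inner ℝ (ψ s a s') (θp h)
  trans_eq : ∀ h s a,
    M.trans h (s, a) = μ.withDensity fun s' => ENNReal.ofReal (inner ℝ (ψ s a s') (θp h))
  reward_eq : ∀ h s a, M.meanReward h s a = inner ℝ (φ s a) (θr h)
  norm_φ : ∀ s a, ‖φ s a‖ ≤ 1
  norm_valueFeature : ∀ V : S → ℝ, Measurable V → (∀ s, V s ∈ Set.Icc (0 : ℝ) H) →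
    ∀ s a, ‖valueFeature μ ψ V s a‖ ≤ Real.sqrt d₁ * H

/-! ### The interaction over `K` episodes -/

/-- The random trajectories `s_1^k, a_1^k, r_1^k, …, s_H^k, a_H^k, r_H^k, s_{H+1}^k` of the
episodes `k`. States are indexed by `Fin (H + 1)`: at step `h : Fin H` the current state is
`state k h.castSucc` and the next one is `state k h.succ`. -/
structure Trajectories (Ω S A : Type*) (K H : ℕ) where
  state : Fin K → Fin (H + 1) → Ω → S
  action : Fin K → Fin H → Ω → A
  reward : Fin K → Fin H → Ω → ℝ

section Interaction

variable {Ω S A : Type*} [mΩ : MeasurableSpace Ω] [mS : MeasurableSpace S]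
  [mA : MeasurableSpace A] {K H : ℕ}

/-- The `σ`-algebra generated by the whole trajectory of episode `j`. -/
def episodeData (T : Trajectories Ω S A K H) (j : Fin K) : MeasurableSpace Ω :=
  (⨆ i, mS.comap (T.state j i)) ⊔ (⨆ i, mA.comap (T.action j i)) ⊔
    ⨆ i, (borel ℝ).comap (T.reward j i)

/-- The information available before episode `k`: the trajectories of the earlier episodes,
and the `σ`-algebra `𝓤 k` of whatever else the agent has at its disposal then (its own
randomization, the output of the regularizer). -/
def startInfo (𝓤 : Filtration (Fin K) mΩ) (T : Trajectories Ω S A K H) (k : Fin K) :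
    MeasurableSpace Ω :=
  𝓤 k ⊔ ⨆ j, ⨆ _ : j < k, episodeData T j

/-- The information available at step `h` of episode `k`, once the action has been chosen and
before the reward and the next state are drawn. -/
def history (𝓤 : Filtration (Fin K) mΩ) (T : Trajectories Ω S A K H) (k : Fin K) (h : Fin H) :
    MeasurableSpace Ω :=
  startInfo 𝓤 T k ⊔ (⨆ i, ⨆ _ : i ≤ h.castSucc, mS.comap (T.state k i)) ⊔
    (⨆ i, ⨆ _ : i ≤ h, mA.comap (T.action k i)) ⊔
    ⨆ i, ⨆ _ : i < h, (borel ℝ).comap (T.reward k i)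

/-- The trajectories arise from interacting with the MDP `M`: given the history, the reward
is drawn from the reward distribution and the next state from the transition probability, both
at the current state and action. How the agent chooses the actions (and which initial states it
meets) is unrestricted. -/
structure IsInteraction (M : EpisodicMDP S A H) (P : Measure Ω) (𝓤 : Filtration (Fin K) mΩ)
    (T : Trajectories Ω S A K H) : Prop where
  measurable_state : ∀ k i, Measurable (T.state k i)
  measurable_action : ∀ k i, Measurable (T.action k i)
  measurable_reward : ∀ k i, Measurable (T.reward k i)
  reward_law : ∀ k h (B : Set ℝ), MeasurableSet B →
    P⟦T.reward k h ⁻¹' B | history 𝓤 T k h⟧ =ᵐ[P]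
      fun ω => (M.reward h (T.state k h.castSucc ω, T.action k h ω)).real B
  state_law : ∀ k h (B : Set S), MeasurableSet B →
    P⟦T.state k h.succ ⁻¹' B | history 𝓤 T k h⟧ =ᵐ[P]
      fun ω => (M.trans h (T.state k h.castSucc ω, T.action k h ω)).real B

/-- `V k h ω` is the value function `V_h^k` (for `h = 1, …, H + 1`, here `h : Fin (H + 1)`)
that the agent maintains. It is computed from the information available before episode `k`,
and its values lie in `[0, H]`. -/
structure IsValueEstimate (𝓤 : Filtration (Fin K) mΩ) (T : Trajectories Ω S A K H)
    (V : Fin K → Fin (H + 1) → Ω → S → ℝ) : Prop where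
  measurable : ∀ k h,
    Measurable[(startInfo 𝓤 T k).prod mS] fun p : Ω × S => V k h p.1 p.2
  mem_Icc : ∀ k h ω s, V k h ω s ∈ Set.Icc (0 : ℝ) H

/-- The feature vectors `φ_h^j(s_h^j, a_h^j)`, `j ∈ [K]`, of the regression for `θ_{h,p}`. -/
noncomputable def transFeatures {d₁ : ℕ} (μ : Measure S) (ψ : S → A → S → Vec d₁)
    (T : Trajectories Ω S A K H) (V : Fin K → Fin (H + 1) → Ω → S → ℝ) (h : Fin H) (ω : Ω) :
    Fin K → Vec d₁ :=
  fun j => valueFeature μ ψ (V j h.succ ω) (T.state j h.castSucc ω) (T.action j h ω)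

/-- The responses `V_{h+1}^j(s_{h+1}^j)`, `j ∈ [K]`, of the regression for `θ_{h,p}`. -/
def transResponses (T : Trajectories Ω S A K H) (V : Fin K → Fin (H + 1) → Ω → S → ℝ)
    (h : Fin H) (ω : Ω) : Fin K → ℝ :=
  fun j => V j h.succ ω (T.state j h.succ ω)

/-- The feature vectors `φ(s_h^j, a_h^j)`, `j ∈ [K]`, of the regression for `θ_{h,r}`. -/
def rewardFeatures {d₂ : ℕ} (φ : S → A → Vec d₂) (T : Trajectories Ω S A K H) (h : Fin H)
    (ω : Ω) : Fin K → Vec d₂ :=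
  fun j => φ (T.state j h.castSucc ω) (T.action j h ω)

/-- The responses `r_h^j`, `j ∈ [K]`, of the regression for `θ_{h,r}`. -/
def rewardResponses (T : Trajectories Ω S A K H) (h : Fin H) (ω : Ω) : Fin K → ℝ :=
  fun j => T.reward j h ω

end Interaction

/-! ### Regularized least squares -/

section Regression

variable {K d : ℕ}

/-- `Λ^k = Z + ∑_{j < k} x_j x_jᵀ`. -/
noncomputable def regGram (Z : Matrix (Fin d) (Fin d) ℝ) (x : Fin K → Vec d) (k : Fin K) :
    Matrix (Fin d) (Fin d) ℝ :=
  Z + ∑ j ∈ Finset.Iio k, Matrix.vecMulVec (x j).ofLp (x j).ofLp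

/-- `u^k = ∑_{j < k} y_j x_j + z`. -/
noncomputable def regTarget (z : Vec d) (x : Fin K → Vec d) (y : Fin K → ℝ) (k : Fin K) :
    Vec d :=
  ∑ j ∈ Finset.Iio k, y j • x j + z

/-- `θ̂^k = (Λ^k)⁻¹ u^k`. -/
noncomputable def regEstimator (Z : Matrix (Fin d) (Fin d) ℝ) (z : Vec d) (x : Fin K → Vec d)
    (y : Fin K → ℝ) (k : Fin K) : Vec d :=
  WithLp.toLp 2 ((regGram Z x k)⁻¹.mulVec (regTarget z x y k).ofLp)

end Regression

/-- The event that, for all `k` and `h`, the regularizers are positive definite with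
`‖Z_h^k‖ ≤ lmax`, `‖(Z_h^k)⁻¹‖ ≤ 1 / lmin` and `‖z_h^k‖_{(Z_h^k)⁻¹} ≤ ν`. -/
def regularEvent {Ω : Type*} {K H d : ℕ} (Z : Fin K → Fin H → Ω → Matrix (Fin d) (Fin d) ℝ)
    (z : Fin K → Fin H → Ω → Vec d) (lmax lmin ν : ℝ) : Set Ω :=
  {ω | ∀ k h, (Z k h ω).PosDef ∧ opNorm (Z k h ω) ≤ lmax ∧ opNorm (Z k h ω)⁻¹ ≤ 1 / lmin ∧
    wnorm (Z k h ω)⁻¹ (z k h ω) ≤ ν}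

/-- The radius `β_p(α)`. -/
noncomputable def betaP (K H d₁ : ℕ) (lmax lmin ν α : ℝ) : ℝ :=
  H / 2 * Real.sqrt (2 * Real.log (H / α) + d₁ * Real.log (1 + K * (H : ℝ) ^ 2 / lmin)) +
    Real.sqrt (d₁ * lmax) + ν

/-- The radius `β_r(α)`. -/
noncomputable def betaR (K H d₂ : ℕ) (lmax lmin ν α : ℝ) : ℝ :=
  1 / 2 * Real.sqrt (2 * Real.log (H / α) + d₂ * Real.log (1 + K / (d₂ * lmin))) +
    Real.sqrt (d₂ * lmax) + ν

end LinMix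

open LinMix

/-! The regularizers `Z`, `z` may depend on the data in any way, so they never enter a martingale.
Writing `e` for the estimation error and `S` for the noise sum, the normal equations read `Λ e = Z θ
- S - z`. Pairing with `e` gives `‖e‖_Λ²` as a sum of three terms. Those with `Z θ` and `z` are
handled by Cauchy–Schwarz in the norm of `Z ≤ Λ`. The one with `S` is handled by duality for `lmin •
1 + ∑ x xᵀ ≤ Λ`, whose regularizer is deterministic. This is `wnorm_sub_regEstimator_le`; it holds
pathwise.

What remains is a self-normalized bound for `S` with regularizer `lmin • 1`, uniform in the episode
(`measure_exists_lt_quadForm_le`). The process `(det V / l ^ d)^(-1/2) exp (‖S‖²_{V⁻¹} / 2)` is a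
supermartingale: each step multiplies it by a Gaussian average of `exp (t η - t² / 2)` over `t`
whose mean and variance are known before the noise `η` is drawn. Ville's inequality bounds its
maximum, and the arithmetic-geometric mean inequality bounds the determinant.

The noise is subgaussian by Hoeffding's lemma, applied to the conditional law with the value
function frozen. The linear mixture assumption makes its mean linear in the feature. A union bound
over the `H` steps and the two regressions concludes. -/

namespace LinMix

/-! ### Linear algebra of positive definite matrices -/

section MatrixLemmas

open Matrix

variable {d : ℕ}

lemma dotProduct_mulVec_comm {M : Matrix (Fin d) (Fin d) ℝ} (hM : M.IsHermitian)
    (u v : Fin d → ℝ) : u ⬝ᵥ M *ᵥ v = v ⬝ᵥ M *ᵥ u := by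
  have hT : Mᵀ = M := by simpa [Matrix.IsHermitian] using hM
  rw [dotProduct_mulVec, ← mulVec_transpose, hT, dotProduct_comm]

lemma quadForm_nonneg {M : Matrix (Fin d) (Fin d) ℝ} (hM : M.PosSemidef) (u : Fin d → ℝ) :
    0 ≤ u ⬝ᵥ M *ᵥ u := by
  simpa using hM.dotProduct_mulVec_nonneg u

/-- The Cauchy–Schwarz inequality for a positive semidefinite matrix. -/
lemma dotProduct_mulVec_sq_le {M : Matrix (Fin d) (Fin d) ℝ} (hM : M.PosSemidef)
    (u v : Fin d → ℝ) : (u ⬝ᵥ M *ᵥ v) ^ 2 ≤ (u ⬝ᵥ M *ᵥ u) * (v ⬝ᵥ M *ᵥ v) := by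
  have h : ∀ t : ℝ, 0 ≤ (v ⬝ᵥ M *ᵥ v) * (t * t) + (2 * (u ⬝ᵥ M *ᵥ v)) * t + u ⬝ᵥ M *ᵥ u := by
    intro t
    have := quadForm_nonneg hM (u + t • v)
    simp only [mulVec_add, mulVec_smul, dotProduct_add, add_dotProduct, dotProduct_smul,
      smul_dotProduct, smul_eq_mul, dotProduct_mulVec_comm hM.1 v u] at this
    linarith
  have := discrim_le_zero h
  unfold discrim at this
  linarith

lemma mulVec_inv_mulVec {M : Matrix (Fin d) (Fin d) ℝ} (hM : M.PosDef) (u : Fin d → ℝ) :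
    M *ᵥ (M⁻¹ *ᵥ u) = u := by
  rw [mulVec_mulVec, mul_nonsing_inv _ ((isUnit_iff_isUnit_det M).1 hM.isUnit), one_mulVec]

lemma inv_mulVec_mulVec {M : Matrix (Fin d) (Fin d) ℝ} (hM : M.PosDef) (u : Fin d → ℝ) :
    M⁻¹ *ᵥ (M *ᵥ u) = u := by
  rw [mulVec_mulVec, nonsing_inv_mul _ ((isUnit_iff_isUnit_det M).1 hM.isUnit), one_mulVec]

/-- Duality between the norms weighted by `M` and by `M⁻¹`. -/
lemma dotProduct_sq_le_inv {M : Matrix (Fin d) (Fin d) ℝ} (hM : M.PosDef) (u v : Fin d → ℝ) :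
    (u ⬝ᵥ v) ^ 2 ≤ (u ⬝ᵥ M *ᵥ u) * (v ⬝ᵥ M⁻¹ *ᵥ v) := by
  have h := dotProduct_mulVec_sq_le hM.posSemidef u (M⁻¹ *ᵥ v)
  rwa [mulVec_inv_mulVec hM, dotProduct_comm (M⁻¹ *ᵥ v)] at h

lemma dotProduct_self_eq_norm_sq (x : Vec d) : x.ofLp ⬝ᵥ x.ofLp = ‖x‖ ^ 2 := by
  rw [EuclideanSpace.norm_sq_eq]
  simp [dotProduct, sq]

lemma quadForm_le_opNorm (M : Matrix (Fin d) (Fin d) ℝ) (x : Vec d) :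
    x.ofLp ⬝ᵥ M *ᵥ x.ofLp ≤ opNorm M * ‖x‖ ^ 2 := by
  rw [← inner_toEuclideanCLM, opNorm]
  calc _ ≤ ‖x‖ * ‖toEuclideanCLM (n := Fin d) (𝕜 := ℝ) M x‖ := real_inner_le_norm _ _
    _ ≤ ‖x‖ * (‖toEuclideanCLM (n := Fin d) (𝕜 := ℝ) M‖ * ‖x‖) := by
      gcongr
      exact ContinuousLinearMap.le_opNorm _ _
    _ = _ := by ring

/-- A bound on the spectral norm of the inverse is a lower bound on the quadratic form. -/
lemma le_quadForm_of_opNorm_inv_le {M : Matrix (Fin d) (Fin d) ℝ} (hM : M.PosDef) {l : ℝ}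
    (hl : 0 < l) (h : opNorm M⁻¹ ≤ 1 / l) (x : Vec d) :
    l * ‖x‖ ^ 2 ≤ x.ofLp ⬝ᵥ M *ᵥ x.ofLp := by
  rcases eq_or_ne x 0 with rfl | hx
  · simp
  have hx' : 0 < ‖x‖ ^ 2 := by positivity
  have h1 := dotProduct_sq_le_inv hM x.ofLp x.ofLp
  have h2 := (quadForm_le_opNorm M⁻¹ x).trans (mul_le_mul_of_nonneg_right h hx'.le)
  have h3 := quadForm_nonneg hM.posSemidef x.ofLp
  rw [dotProduct_self_eq_norm_sq] at h1
  have h4 := h1.trans (mul_le_mul_of_nonneg_left h2 h3)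
  rw [sq, ← mul_assoc] at h4
  have h5 := le_of_mul_le_mul_right h4 hx'
  rw [mul_one_div, le_div_iff₀ hl] at h5
  linarith

/-- The matrix determinant lemma; it gives the growth of the normalizing determinant when one
observation is added. -/
lemma det_add_vecMulVec_self {V : Matrix (Fin d) (Fin d) ℝ} (hV : V.PosDef) (x : Fin d → ℝ) :
    (V + vecMulVec x x).det = V.det * (1 + x ⬝ᵥ V⁻¹ *ᵥ x) := by
  have h := det_add_replicateCol_mul_replicateRow (ι := Unit) (A := V)
    ((isUnit_iff_isUnit_det V).1 hV.isUnit) x x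
  rw [vecMulVec_eq Unit, h]
  congr 2
  rw [dotProduct_mulVec]
  simp [vecMul, mul_apply, dotProduct]

lemma posSemidef_vecMulVec_self (x : Fin d → ℝ) : (vecMulVec x x).PosSemidef := by
  simpa using posSemidef_vecMulVec_self_star x

/-- The effect of a rank one update on the self-normalized quadratic form. -/
lemma quadForm_inv_add_vecMulVec {V : Matrix (Fin d) (Fin d) ℝ} (hV : V.PosDef)
    (x s : Fin d → ℝ) (y : ℝ) :
    (s + y • x) ⬝ᵥ (V + vecMulVec x x)⁻¹ *ᵥ (s + y • x) =
      s ⬝ᵥ V⁻¹ *ᵥ s + (2 * (x ⬝ᵥ V⁻¹ *ᵥ s) * y + (x ⬝ᵥ V⁻¹ *ᵥ x) * y ^ 2 - (x ⬝ᵥ V⁻¹ *ᵥ s) ^ 2) /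
        (1 + x ⬝ᵥ V⁻¹ *ᵥ x) := by
  have ha := quadForm_nonneg hV.inv.posSemidef x
  set a := x ⬝ᵥ V⁻¹ *ᵥ x with ha_def
  set b := x ⬝ᵥ V⁻¹ *ᵥ s with hb_def
  have hV' : (V + vecMulVec x x).PosDef := hV.add_posSemidef (posSemidef_vecMulVec_self x)
  have ha1 : 1 + a ≠ 0 := by positivity
  -- Instead of inverting the updated matrix, solve for the preimage of `s + y • x` with the ansatz
  -- `V⁻¹ (s + c x)`. Comparing coefficients of `x` gives `c + b + c a = y`.
  set c := (y - b) / (1 + a) with hc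
  have hw : (V + vecMulVec x x) *ᵥ (V⁻¹ *ᵥ s + c • V⁻¹ *ᵥ x) = s + y • x := by
    rw [add_mulVec, mulVec_add, mulVec_smul, mulVec_inv_mulVec hV, mulVec_inv_mulVec hV,
      vecMulVec_mulVec, dotProduct_add, dotProduct_smul, ← ha_def, ← hb_def, add_assoc]
    ext i
    simp only [Pi.add_apply, Pi.smul_apply, smul_eq_mul, MulOpposite.smul_eq_mul_unop,
      MulOpposite.unop_op, hc]
    field_simp
    ring
  rw [← hw, inv_mulVec_mulVec hV', hw, add_dotProduct, dotProduct_add, dotProduct_add,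
    dotProduct_smul, dotProduct_smul, smul_dotProduct, smul_dotProduct,
    dotProduct_mulVec_comm hV.inv.1 s x, ← ha_def, ← hb_def]
  simp only [smul_eq_mul, hc]
  field_simp
  ring

/-- The determinant of a positive semidefinite matrix, by the inequality between the arithmetic
and the geometric mean of the eigenvalues. -/
lemma det_le_trace_div_pow {M : Matrix (Fin d) (Fin d) ℝ} (hM : M.PosSemidef) :
    M.det ≤ (M.trace / d) ^ d := by
  rcases Nat.eq_zero_or_pos d with rfl | hd
  · simp
  have hdR : (0 : ℝ) < d := by exact_mod_cast hd
  have h0 := hM.eigenvalues_nonneg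
  rw [hM.1.det_eq_prod_eigenvalues, hM.1.trace_eq_sum_eigenvalues]
  simp only [RCLike.ofReal_real_eq_id, id_eq]
  have h := Real.geom_mean_le_arith_mean Finset.univ (fun _ => (1 : ℝ)) hM.1.eigenvalues
    (fun _ _ => zero_le_one) (by simpa using hd) (fun i _ => h0 i)
  simp only [Real.rpow_one, one_mul, Finset.sum_const, Finset.card_univ, Fintype.card_fin,
    nsmul_eq_mul, mul_one] at h
  have hp : 0 ≤ ∏ i, hM.1.eigenvalues i := Finset.prod_nonneg fun i _ => h0 i
  calc ∏ i, hM.1.eigenvalues i = ((∏ i, hM.1.eigenvalues i) ^ ((d : ℝ)⁻¹)) ^ d := by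
        rw [Real.rpow_inv_natCast_pow hp hd.ne']
    _ ≤ _ := by gcongr

end MatrixLemmas

/-! ### Pathwise error bound and determinant bound -/

section Regression

open Matrix

variable {K d : ℕ}

lemma posSemidef_sum_vecMulVec (s : Finset (Fin K)) (x : Fin K → Vec d) :
    (∑ j ∈ s, vecMulVec (x j).ofLp (x j).ofLp).PosSemidef :=
  posSemidef_sum s fun _ _ => posSemidef_vecMulVec_self _

lemma regGram_posDef {Z : Matrix (Fin d) (Fin d) ℝ} (hZ : Z.PosDef) (x : Fin K → Vec d)
    (k : Fin K) : (regGram Z x k).PosDef :=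
  hZ.add_posSemidef (posSemidef_sum_vecMulVec _ x)

lemma smul_one_posDef {l : ℝ} (hl : 0 < l) : (l • (1 : Matrix (Fin d) (Fin d) ℝ)).PosDef :=
  Matrix.PosDef.one.smul hl

/-- The error of regularized least squares splits into the noise, measured in the norm given by
the constant regularizer `lmin • 1`, and the two contributions of the regularizer. -/
lemma wnorm_sub_regEstimator_le {Z : Matrix (Fin d) (Fin d) ℝ} {z θ : Vec d} {x : Fin K → Vec d}
    {y : Fin K → ℝ} {k : Fin K} {lmax lmin ν B : ℝ} (hlmin : 0 < lmin) (hZ : Z.PosDef)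
    (hmax : opNorm Z ≤ lmax) (hmin : opNorm Z⁻¹ ≤ 1 / lmin) (hz : wnorm Z⁻¹ z ≤ ν)
    (hθ : ‖θ‖ ≤ √d)
    (hB : wnorm (regGram (lmin • 1) x k)⁻¹
      (∑ j ∈ Finset.Iio k, (y j - inner ℝ (x j) θ) • x j) ≤ B) :
    wnorm (regGram Z x k) (θ - regEstimator Z z x y k) ≤ B + √(d * lmax) + ν := by
  have hΛ := regGram_posDef hZ x k
  have hV : (regGram (lmin • 1) x k).PosDef := regGram_posDef (smul_one_posDef hlmin) x k
  set Λ := regGram Z x k with hΛdef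
  set S : Vec d := ∑ j ∈ Finset.Iio k, (y j - inner ℝ (x j) θ) • x j with hS
  set e : Vec d := θ - regEstimator Z z x y k with he
  -- The normal equations: multiplying by `Λ` cancels the inverse in the estimator, and the rank one
  -- part of `Λ θ` turns the responses into noise.
  have hΛe : Λ *ᵥ e.ofLp = Z *ᵥ θ.ofLp - S.ofLp - z.ofLp := by
    rw [he, WithLp.ofLp_sub, mulVec_sub, regEstimator]
    rw [mulVec_inv_mulVec hΛ, hΛdef, regGram, regTarget, add_mulVec, sum_mulVec, hS]
    simp only [WithLp.ofLp_add, WithLp.ofLp_sub, WithLp.ofLp_sum, WithLp.ofLp_smul, sub_smul,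
      Finset.sum_sub_distrib, vecMulVec_mulVec]
    have : ∀ j, MulOpposite.op ((x j).ofLp ⬝ᵥ θ.ofLp) • (x j).ofLp
        = inner ℝ (x j) θ • (x j).ofLp := by
      intro j
      ext i
      simp [EuclideanSpace.inner_eq_star_dotProduct, dotProduct_comm, mul_comm]
    simp only [this]
    abel
  have hnn := quadForm_nonneg hΛ.posSemidef e.ofLp
  have hZe : e.ofLp ⬝ᵥ Z *ᵥ e.ofLp ≤ e.ofLp ⬝ᵥ Λ *ᵥ e.ofLp := by
    rw [hΛdef, regGram, add_mulVec, dotProduct_add]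
    linarith [quadForm_nonneg (posSemidef_sum_vecMulVec (Finset.Iio k) x) e.ofLp]
  -- The arbitrary `Z` is exchanged here for its deterministic lower bound `lmin • 1`.
  have hVe : e.ofLp ⬝ᵥ (regGram (lmin • 1) x k) *ᵥ e.ofLp ≤ e.ofLp ⬝ᵥ Λ *ᵥ e.ofLp := by
    rw [hΛdef, regGram, regGram, add_mulVec, dotProduct_add, add_mulVec, dotProduct_add,
      smul_mulVec, one_mulVec, dotProduct_smul, dotProduct_self_eq_norm_sq]
    gcongr
    exact le_quadForm_of_opNorm_inv_le hZ hlmin hmin e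
  set q := wnorm Λ e with hq
  have hq0 : 0 ≤ q := Real.sqrt_nonneg _
  have hqq : q ^ 2 = e.ofLp ⬝ᵥ Λ *ᵥ e.ofLp := Real.sq_sqrt hnn
  have key : ∀ c r t : ℝ, c ^ 2 ≤ r * t → r ≤ q ^ 2 → 0 ≤ t → |c| ≤ q * √t := by
    intro c r t h1 h2 ht
    refine abs_le_of_sq_le_sq (h1.trans ?_) (by positivity)
    rw [mul_pow, Real.sq_sqrt ht]
    gcongr
  have h1 : |e.ofLp ⬝ᵥ S.ofLp| ≤ q * B :=
    (key _ _ _ (dotProduct_sq_le_inv hV _ _) (hVe.trans hqq.ge)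
      (quadForm_nonneg hV.inv.posSemidef _)).trans (mul_le_mul_of_nonneg_left hB hq0)
  have h2 : |e.ofLp ⬝ᵥ z.ofLp| ≤ q * ν :=
    (key _ _ _ (dotProduct_sq_le_inv hZ _ _) (hZe.trans hqq.ge)
      (quadForm_nonneg hZ.inv.posSemidef _)).trans (mul_le_mul_of_nonneg_left hz hq0)
  have hθ2 : θ.ofLp ⬝ᵥ Z *ᵥ θ.ofLp ≤ d * lmax := by
    have hop : 0 ≤ opNorm Z := norm_nonneg _
    calc _ ≤ opNorm Z * ‖θ‖ ^ 2 := quadForm_le_opNorm Z θ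
      _ ≤ lmax * √d ^ 2 := by gcongr; exact hop.trans hmax
      _ = d * lmax := by rw [Real.sq_sqrt (Nat.cast_nonneg d), mul_comm]
  have h3 : |e.ofLp ⬝ᵥ Z *ᵥ θ.ofLp| ≤ q * √(d * lmax) :=
    (key _ _ _ (dotProduct_mulVec_sq_le hZ.posSemidef _ _) (hZe.trans hqq.ge)
      (quadForm_nonneg hZ.posSemidef _)).trans
        (mul_le_mul_of_nonneg_left (Real.sqrt_le_sqrt hθ2) hq0)
  have hfin : q * q ≤ q * (B + √(d * lmax) + ν) := by
    rw [← sq, hqq, hΛe, dotProduct_sub, dotProduct_sub]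
    linarith [neg_abs_le (e.ofLp ⬝ᵥ S.ofLp), neg_abs_le (e.ofLp ⬝ᵥ z.ofLp),
      le_abs_self (e.ofLp ⬝ᵥ Z *ᵥ θ.ofLp)]
  -- Cancelling `q` requires `q > 0`; for `q = 0` the right side is nonnegative, since `B` and `ν`
  -- dominate square roots.
  rcases hq0.eq_or_lt with h0 | h0
  · rw [← h0]
    have : 0 ≤ B := (Real.sqrt_nonneg _).trans hB
    have : 0 ≤ ν := (Real.sqrt_nonneg _).trans hz
    positivity
  · exact le_of_mul_le_mul_left hfin h0

/-- The determinant bound for a sum of `k` rank one matrices. -/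
lemma log_det_regGram_div_le {l L : ℝ} (hl : 0 < l) {x : Fin K → Vec d} {k : Fin K}
    (hx : ∀ j, ‖x j‖ ^ 2 ≤ L) :
    Real.log ((regGram (l • 1) x k).det / l ^ d) ≤ d * Real.log (1 + K * L / (d * l)) := by
  rcases Nat.eq_zero_or_pos d with rfl | hd
  · simp
  have hdR : (0 : ℝ) < d := by exact_mod_cast hd
  have hV : (regGram (l • 1) x k).PosDef := regGram_posDef (smul_one_posDef hl) x k
  have hL : 0 ≤ L := (sq_nonneg _).trans (hx k)
  have htr : (regGram (l • 1) x k).trace ≤ d * l + K * L := by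
    rw [regGram, trace_add, trace_smul, trace_one, trace_sum, Fintype.card_fin, smul_eq_mul,
      mul_comm l]
    gcongr
    calc ∑ j ∈ Finset.Iio k, (vecMulVec (x j).ofLp (x j).ofLp).trace
        ≤ ∑ j ∈ Finset.Iio k, L := by
          gcongr with j
          rw [trace_vecMulVec, dotProduct_self_eq_norm_sq]
          exact hx j
      _ = k * L := by simp
      _ ≤ K * L := by gcongr; exact k.2.le
  have htr0 : 0 ≤ (regGram (l • 1) x k).trace := hV.posSemidef.trace_nonneg
  have h1 : (regGram (l • 1) x k).det / l ^ d ≤ (1 + K * L / (d * l)) ^ d := by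
    calc _ ≤ ((regGram (l • 1) x k).trace / d) ^ d / l ^ d := by
          gcongr
          exact det_le_trace_div_pow hV.posSemidef
      _ ≤ ((d * l + K * L) / d) ^ d / l ^ d := by gcongr
      _ = _ := by
          rw [← div_pow]
          congr 1
          field_simp
  have h2 := Real.log_le_log (by have := hV.det_pos; positivity) h1
  rwa [Real.log_pow] at h2

end Regression

open scoped ENNReal NNReal

/-! ### Gaussian mixtures and the maximal inequality -/

section Subgaussian

variable {Ω : Type*}

/-- `η` is conditionally `1`-subgaussian given `m`, in integrated form. -/
def IsCondSubgaussian (m : MeasurableSpace Ω) {mΩ : MeasurableSpace Ω} (P : Measure Ω)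
    (η : Ω → ℝ) : Prop :=
  ∀ (f : Ω → ℝ≥0∞) (s : Ω → ℝ), Measurable[m] f → Measurable[m] s →
    ∫⁻ ω, f ω * ENNReal.ofReal (Real.exp (s ω * η ω - s ω ^ 2 / 2)) ∂P ≤ ∫⁻ ω, f ω ∂P

/-- The Gaussian mixture of the exponentials `exp (t y - t ^ 2 / 2)`, for `t` with mean `b` and
variance `a`. -/
lemma lintegral_gaussianReal_exp {a : ℝ} (ha : 0 ≤ a) (b y : ℝ) :
    ∫⁻ g, ENNReal.ofReal (Real.exp ((b + √a * g) * y - (b + √a * g) ^ 2 / 2)) ∂gaussianReal 0 1 =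
      ENNReal.ofReal ((√(1 + a))⁻¹ *
        Real.exp ((2 * b * y + a * y ^ 2 - b ^ 2) / (1 + a) / 2)) := by
  have ha1 : 0 < 1 + a := by positivity
  set v : ℝ≥0 := ⟨(1 + a)⁻¹, by positivity⟩ with hv
  have hvr : (v : ℝ) = (1 + a)⁻¹ := rfl
  have hv0 : v ≠ 0 := by
    rw [← NNReal.coe_ne_zero, hvr]
    positivity
  -- Completing the square in `g`: the tilted standard Gaussian has variance `1 / (1 + a)` and this
  -- mean.
  set mn : ℝ := √a * (y - b) / (1 + a) with hmn
  rw [gaussianReal_of_var_ne_zero 0 one_ne_zero,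
    lintegral_withDensity_eq_lintegral_mul _ (measurable_gaussianPDF 0 1) (by fun_prop)]
  have hpt : ∀ g : ℝ, (gaussianPDF 0 1 * fun g => ENNReal.ofReal
      (Real.exp ((b + √a * g) * y - (b + √a * g) ^ 2 / 2))) g =
      ENNReal.ofReal ((√(1 + a))⁻¹ * Real.exp ((2 * b * y + a * y ^ 2 - b ^ 2) / (1 + a) / 2)) *
        gaussianPDF mn v g := by
    intro g
    rw [Pi.mul_apply, gaussianPDF, gaussianPDF, ← ENNReal.ofReal_mul (gaussianPDFReal_nonneg _ _ _),
      ← ENNReal.ofReal_mul (by positivity)]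
    congr 1
    rw [gaussianPDFReal, gaussianPDFReal, hvr]
    have h1 : (√(2 * Real.pi * (1 + a)⁻¹))⁻¹ = (√(2 * Real.pi * (1 : ℝ≥0)))⁻¹ * √(1 + a) := by
      rw [Real.sqrt_mul (by positivity) (1 + a)⁻¹, Real.sqrt_inv, mul_inv, inv_inv]
      simp
    have h2 : √(1 + a) ≠ 0 := by positivity
    rw [h1]
    have h3 : ∀ A B C D s : ℝ, s ≠ 0 → Real.exp A * Real.exp B = Real.exp C * Real.exp D →
        ∀ p : ℝ, p * Real.exp A * Real.exp B = s⁻¹ * Real.exp C * (p * s * Real.exp D) := by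
      intro A B C D s hs h p
      rw [mul_assoc, h]
      field_simp
    refine h3 _ _ _ _ _ h2 ?_ _
    rw [← Real.exp_add, ← Real.exp_add]
    congr 1
    have hsq : √a ^ 2 = a := Real.sq_sqrt ha
    rw [hmn]
    -- With `√a` a free variable and `a = r ^ 2`, the identity of exponents is one of rational
    -- functions.
    generalize √a = r at *
    subst hsq
    simp only [NNReal.coe_one]
    field_simp
    ring
  simp_rw [hpt]
  rw [lintegral_const_mul _ (measurable_gaussianPDF _ _), lintegral_gaussianPDF_eq_one _ hv0,
    mul_one]

/-- For each fixed `g`, the exponent `b + √a g` is `m`-measurable, so subgaussianity applies to it;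
Tonelli then averages over `g`. The weight `f` stands in for conditioning on `m`. -/
lemma IsCondSubgaussian.lintegral_mixture_le {m mΩ : MeasurableSpace Ω} {P : Measure Ω}
    [SFinite P] (hm : m ≤ mΩ) {η : Ω → ℝ} (h : IsCondSubgaussian m P η) (hη : Measurable η)
    {f : Ω → ℝ≥0∞} {a b : Ω → ℝ} (hf : Measurable[m] f) (ha : Measurable[m] a)
    (hb : Measurable[m] b) (ha0 : ∀ ω, 0 ≤ a ω) :
    ∫⁻ ω, f ω * ENNReal.ofReal ((√(1 + a ω))⁻¹ *
        Real.exp ((2 * b ω * η ω + a ω * η ω ^ 2 - b ω ^ 2) / (1 + a ω) / 2)) ∂P ≤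
      ∫⁻ ω, f ω ∂P := by
  have hf' : Measurable f := hf.mono hm le_rfl
  have ha' : Measurable a := ha.mono hm le_rfl
  have hb' : Measurable b := hb.mono hm le_rfl
  have hmeas : Measurable (Function.uncurry fun (ω : Ω) (g : ℝ) => f ω * ENNReal.ofReal
      (Real.exp ((b ω + √(a ω) * g) * η ω - (b ω + √(a ω) * g) ^ 2 / 2))) := by
    unfold Function.uncurry
    fun_prop
  calc _ = ∫⁻ ω, ∫⁻ g, f ω * ENNReal.ofReal
        (Real.exp ((b ω + √(a ω) * g) * η ω - (b ω + √(a ω) * g) ^ 2 / 2)) ∂gaussianReal 0 1 ∂P := by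
        refine lintegral_congr fun ω => ?_
        rw [lintegral_const_mul _ (by fun_prop), lintegral_gaussianReal_exp (ha0 ω)]
    _ = ∫⁻ g, ∫⁻ ω, f ω * ENNReal.ofReal
        (Real.exp ((b ω + √(a ω) * g) * η ω - (b ω + √(a ω) * g) ^ 2 / 2)) ∂P ∂gaussianReal 0 1 :=
        lintegral_lintegral_swap hmeas.aemeasurable
    _ ≤ ∫⁻ _, ∫⁻ ω, f ω ∂P ∂gaussianReal 0 1 := by
        refine lintegral_mono fun g => ?_
        exact h f (fun ω => b ω + √(a ω) * g) hf (hb.add (ha.sqrt.mul_const g))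
    _ = ∫⁻ ω, f ω ∂P := by simp

/-- Ville's maximal inequality for a nonnegative supermartingale with finite horizon. -/
lemma mul_measure_exists_le_one {mΩ : MeasurableSpace Ω} {K : ℕ} {P : Measure Ω}
    [IsProbabilityMeasure P] (𝓗 : Filtration (Fin K) mΩ) {X : Fin K → Ω → ℝ≥0∞} (hX : ∀ k, Measurable[𝓗 k] (X k))
    (h0 : ∀ k : Fin K, k.val = 0 → ∀ ω, X k ω ≤ 1)
    (hstep : ∀ k k' : Fin K, k'.val = k.val + 1 → ∀ A, MeasurableSet[𝓗 k] A →
      ∫⁻ ω in A, X k' ω ∂P ≤ ∫⁻ ω in A, X k ω ∂P) (c : ℝ≥0∞) :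
    c * P {ω | ∃ k, c ≤ X k ω} ≤ 1 := by
  have hXm : ∀ k, Measurable (X k) := fun k => (hX k).mono (𝓗.le k) le_rfl
  have hset : ∀ j k : Fin K, j ≤ k → MeasurableSet[𝓗 k] {ω | c ≤ X j ω} := fun j k hjk =>
    𝓗.mono hjk _ (hX j measurableSet_Ici)
  have hB : ∀ k : Fin K, MeasurableSet[𝓗 k] {ω | ∃ j ≤ k, c ≤ X j ω} := by
    intro k
    have : {ω | ∃ j ≤ k, c ≤ X j ω} = ⋃ j, ⋃ _ : j ≤ k, {ω | c ≤ X j ω} := by ext; simp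
    rw [this]
    exact MeasurableSet.iUnion fun j => MeasurableSet.iUnion fun hj => hset j k hj
  -- The invariant is a lower bound for the mean of the process stopped at its first passage above
  -- `c`: at least `c` on the paths that have crossed, the current value on the others.
  have key : ∀ n (hn : n < K), c * P {ω | ∃ j ≤ (⟨n, hn⟩ : Fin K), c ≤ X j ω} +
      ∫⁻ ω in {ω | ∃ j ≤ (⟨n, hn⟩ : Fin K), c ≤ X j ω}ᶜ, X ⟨n, hn⟩ ω ∂P ≤ 1 := by
    intro n
    induction n with
    | zero =>
      intro hn
      set k : Fin K := ⟨0, hn⟩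
      have hBk : MeasurableSet {ω | ∃ j ≤ k, c ≤ X j ω} := 𝓗.le k _ (hB k)
      have hle : ∀ ω ∈ {ω | ∃ j ≤ k, c ≤ X j ω}, c ≤ X k ω := by
        rintro ω ⟨j, hj, hc⟩
        have : j = k := le_antisymm hj (Fin.mk_le_of_le_val (Nat.zero_le _))
        rwa [this] at hc
      calc _ ≤ ∫⁻ ω in {ω | ∃ j ≤ k, c ≤ X j ω}, X k ω ∂P +
            ∫⁻ ω in {ω | ∃ j ≤ k, c ≤ X j ω}ᶜ, X k ω ∂P := by
            gcongr
            rw [← setLIntegral_const]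
            exact setLIntegral_mono (hXm k) hle
        _ = ∫⁻ ω, X k ω ∂P := lintegral_add_compl _ hBk
        _ ≤ ∫⁻ _, 1 ∂P := lintegral_mono fun ω => h0 k rfl ω
        _ = 1 := by simp
    | succ n ih =>
      intro hn
      have hn' : n < K := Nat.lt_of_succ_lt hn
      specialize ih hn'
      set k : Fin K := ⟨n, hn'⟩
      set k' : Fin K := ⟨n + 1, hn⟩
      set B := {ω | ∃ j ≤ k, c ≤ X j ω} with hBdef
      set B' := {ω | ∃ j ≤ k', c ≤ X j ω} with hB'def
      have hkk' : k ≤ k' := Fin.mk_le_mk.2 n.le_succ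
      have hBB' : B ⊆ B' := fun ω ⟨j, hj, hc⟩ => ⟨j, hj.trans hkk', hc⟩
      have hBm : MeasurableSet B := 𝓗.le k _ (hB k)
      have hB'm : MeasurableSet B' := 𝓗.le k' _ (hB k')
      have hle : ∀ ω ∈ B' \ B, c ≤ X k' ω := by
        rintro ω ⟨⟨j, hj, hc⟩, hnB⟩
        have : j = k' := by
          by_contra hne
          refine hnB ⟨j, ?_, hc⟩
          have h1 : j.val < n + 1 := lt_of_le_of_ne hj fun h => hne (Fin.ext h)
          exact Nat.lt_succ_iff.1 h1
        rwa [this] at hc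
      have hsplit : Bᶜ = (B' \ B) ∪ B'ᶜ := by
        ext ω
        by_cases h1 : ω ∈ B <;> by_cases h2 : ω ∈ B' <;> simp [h1, h2]
        exact h2 (hBB' h1)
      have hdisj : Disjoint (B' \ B) B'ᶜ :=
        Set.disjoint_left.2 fun ω h1 h2 => h2 h1.1
      have hPB' : P B' = P B + P (B' \ B) := by
        rw [← measure_union Set.disjoint_sdiff_right (hB'm.diff hBm), Set.union_sdiff_cancel hBB']
      calc c * P B' + ∫⁻ ω in B'ᶜ, X k' ω ∂P
          = c * P B + (c * P (B' \ B) + ∫⁻ ω in B'ᶜ, X k' ω ∂P) := by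
            rw [hPB', mul_add, add_assoc]
        _ ≤ c * P B + (∫⁻ ω in B' \ B, X k' ω ∂P + ∫⁻ ω in B'ᶜ, X k' ω ∂P) := by
            gcongr
            rw [← setLIntegral_const]
            exact setLIntegral_mono (hXm k') hle
        _ = c * P B + ∫⁻ ω in Bᶜ, X k' ω ∂P := by
            rw [hsplit, lintegral_union hB'm.compl hdisj]
        _ ≤ c * P B + ∫⁻ ω in Bᶜ, X k ω ∂P := by
            refine add_le_add le_rfl ?_
            exact hstep k k' rfl _ (hB k).compl
        _ ≤ 1 := ih
  rcases Nat.eq_zero_or_pos K with rfl | hK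
  · simp
  · have hlast := key (K - 1) (Nat.sub_lt hK one_pos)
    refine le_trans ?_ (le_self_add.trans hlast)
    refine mul_le_mul_right (measure_mono ?_) c
    rintro ω ⟨k, hc⟩
    exact ⟨k, Fin.le_def.2 (Nat.le_sub_one_of_lt k.2), hc⟩

end Subgaussian

/-! ### Measurability of determinants, inverses and Gram matrices -/

section Measurability

variable {α : Type*} {mα : MeasurableSpace α} {d K : ℕ}

lemma measurable_det {A : α → Matrix (Fin d) (Fin d) ℝ} (hA : ∀ i j, Measurable fun ω => A ω i j) :
    Measurable fun ω => (A ω).det := by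
  simp only [Matrix.det_apply]
  fun_prop

lemma measurable_inv_apply {A : α → Matrix (Fin d) (Fin d) ℝ}
    (hA : ∀ i j, Measurable fun ω => A ω i j) (i j : Fin d) :
    Measurable fun ω => (A ω)⁻¹ i j := by
  simp only [Matrix.inv_def, Matrix.smul_apply, Ring.inverse_eq_inv', smul_eq_mul,
    Matrix.adjugate_apply]
  refine (measurable_det hA).inv.mul (measurable_det fun i' j' => ?_)
  by_cases h : i' = j
  · subst h
    simp
  · simpa [Matrix.updateRow_ne h] using hA i' j'

lemma measurable_bilin_inv {A : α → Matrix (Fin d) (Fin d) ℝ} {u v : α → Vec d}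
    (hA : ∀ i j, Measurable fun ω => A ω i j) (hu : Measurable u) (hv : Measurable v) :
    Measurable fun ω => (u ω).ofLp ⬝ᵥ Matrix.mulVec (A ω)⁻¹ (v ω).ofLp := by
  have hc : ∀ {w : α → Vec d}, Measurable w → ∀ i, Measurable fun ω => (w ω).ofLp i :=
    fun hw i => by fun_prop
  have hm : ∀ i, Measurable fun ω => Matrix.mulVec (A ω)⁻¹ (v ω).ofLp i := fun i =>
    Finset.measurable_sum Finset.univ fun j _ => (measurable_inv_apply hA i j).mul (hc hv j)
  exact Finset.measurable_sum Finset.univ fun i _ => (hc hu i).mul (hm i)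

lemma measurable_regGram_apply {Z : Matrix (Fin d) (Fin d) ℝ} {x : Fin K → α → Vec d} {k : Fin K}
    (hx : ∀ j < k, Measurable (x j)) (i i' : Fin d) :
    Measurable fun ω => regGram Z (fun j => x j ω) k i i' := by
  simp only [regGram, Matrix.add_apply, Matrix.sum_apply, Matrix.vecMulVec_apply]
  refine measurable_const.add (Finset.measurable_sum _ fun j hj => ?_)
  have := hx j (Finset.mem_Iio.1 hj)
  fun_prop

end Measurability

/-! ### The self-normalized inequality -/

section SelfNormalized

variable {Ω : Type*} [mΩ : MeasurableSpace Ω] {K d : ℕ}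

lemma Iio_eq_insert_of_val_eq {k k' : Fin K} (h : k'.val = k.val + 1) :
    Finset.Iio k' = insert k (Finset.Iio k) := by
  ext j
  simp only [Finset.mem_Iio, Finset.mem_insert, Fin.ext_iff, Fin.lt_def]
  omega

/-- The self-normalized concentration inequality, for the regularizer `l • 1`. -/
theorem measure_exists_lt_quadForm_le (P : Measure Ω) [IsProbabilityMeasure P]
    (𝓗 : Filtration (Fin K) mΩ) {x : Fin K → Ω → Vec d} {η : Fin K → Ω → ℝ}
    (hx : ∀ k, Measurable[𝓗 k] (x k)) (hη : ∀ j k, j < k → Measurable[𝓗 k] (η j))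
    (hη' : ∀ k, Measurable (η k)) (hsub : ∀ k, IsCondSubgaussian (𝓗 k) P (η k))
    {l δ : ℝ} (hl : 0 < l) (hδ : 0 < δ) :
    P {ω | ∃ k : Fin K, 2 * Real.log (1 / δ) +
        Real.log ((regGram (l • 1) (fun j => x j ω) k).det / l ^ d) <
      wnorm (regGram (l • 1) (fun j => x j ω) k)⁻¹ (∑ j ∈ Finset.Iio k, η j ω • x j ω) ^ 2} ≤
      ENNReal.ofReal δ := by
  set V : Fin K → Ω → Matrix (Fin d) (Fin d) ℝ := fun k ω => regGram (l • 1) (fun j => x j ω) k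
    with hVdef
  set S : Fin K → Ω → Vec d := fun k ω => ∑ j ∈ Finset.Iio k, η j ω • x j ω with hSdef
  have hV : ∀ k ω, (V k ω).PosDef := fun k ω => regGram_posDef (smul_one_posDef hl) _ k
  have hVm : ∀ k i j, Measurable[𝓗 k] fun ω => V k ω i j := fun k i i' =>
    measurable_regGram_apply (mα := 𝓗 k) (fun j hj => (hx j).mono (𝓗.mono hj.le) le_rfl) i i'
  have hSm : ∀ k, Measurable[𝓗 k] (S k) := fun k =>
    Finset.measurable_sum _ fun j hj => by
      have hjk := Finset.mem_Iio.1 hj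
      exact (hη j k hjk).smul ((hx j).mono (𝓗.mono hjk.le) le_rfl)
  have hl' : 0 < l ^ d := by positivity
  -- The closed form of the mixture of `exp (⟨v, S⟩ - vᵀ (V - l • 1) v / 2)` over `v` Gaussian with
  -- covariance `l⁻¹ • 1`.
  set X : Fin K → Ω → ℝ≥0∞ := fun k ω => ENNReal.ofReal ((√((V k ω).det / l ^ d))⁻¹ *
    Real.exp (((S k ω).ofLp ⬝ᵥ Matrix.mulVec (V k ω)⁻¹ (S k ω).ofLp) / 2)) with hXdef
  have hXm : ∀ k, Measurable[𝓗 k] (X k) := by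
    intro k
    have h1 := measurable_det (mα := 𝓗 k) (hVm k)
    have h2 := measurable_bilin_inv (mα := 𝓗 k) (hVm k) (hSm k) (hSm k)
    exact (((h1.div_const _).sqrt.inv).mul (h2.div_const 2).exp).ennreal_ofReal
  have h0 : ∀ k : Fin K, k.val = 0 → ∀ ω, X k ω ≤ 1 := by
    intro k hk ω
    have hI : Finset.Iio k = ∅ := by
      ext j
      simp [Fin.lt_def, hk]
    simp only [hXdef, hVdef, hSdef, regGram, hI, Finset.sum_empty, add_zero]
    rw [Matrix.det_smul, Fintype.card_fin, Matrix.det_one, mul_one, div_self hl'.ne']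
    simp
  have hstep : ∀ k k' : Fin K, k'.val = k.val + 1 → ∀ A, MeasurableSet[𝓗 k] A →
      ∫⁻ ω in A, X k' ω ∂P ≤ ∫⁻ ω in A, X k ω ∂P := by
    intro k k' hk A hA
    have hI := Iio_eq_insert_of_val_eq hk
    have hVk : ∀ ω, V k' ω = V k ω + Matrix.vecMulVec (x k ω).ofLp (x k ω).ofLp := by
      intro ω
      simp only [hVdef, regGram, hI]
      rw [Finset.sum_insert (by simp)]
      abel
    have hSk : ∀ ω, S k' ω = S k ω + η k ω • x k ω := by
      intro ω
      simp only [hSdef, hI]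
      rw [Finset.sum_insert (by simp), add_comm]
    set a : Ω → ℝ := fun ω => (x k ω).ofLp ⬝ᵥ Matrix.mulVec (V k ω)⁻¹ (x k ω).ofLp with hadef
    set b : Ω → ℝ := fun ω => (x k ω).ofLp ⬝ᵥ Matrix.mulVec (V k ω)⁻¹ (S k ω).ofLp with hbdef
    have ha : ∀ ω, 0 ≤ a ω := fun ω => quadForm_nonneg (hV k ω).inv.posSemidef _
    -- The determinant lemma and the rank one update together give precisely the mixture factor with
    -- mean `b` and variance `a`, both known before `η k`.
    have hXk : ∀ ω, X k' ω = X k ω * ENNReal.ofReal ((√(1 + a ω))⁻¹ *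
        Real.exp ((2 * b ω * η k ω + a ω * η k ω ^ 2 - b ω ^ 2) / (1 + a ω) / 2)) := by
      intro ω
      have hdet := (hV k ω).det_pos
      simp only [hXdef]
      rw [← ENNReal.ofReal_mul (by positivity)]
      congr 1
      rw [hVk, hSk, det_add_vecMulVec_self (hV k ω), WithLp.ofLp_add, WithLp.ofLp_smul,
        quadForm_inv_add_vecMulVec (hV k ω), add_div, Real.exp_add, mul_div_right_comm,
        Real.sqrt_mul (by positivity), mul_inv]
      simp only [hadef, hbdef]
      ring
    rw [← lintegral_indicator ((𝓗.le k) _ hA), ← lintegral_indicator ((𝓗.le k) _ hA)]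
    -- The indicator of `A` is absorbed into the weight `f` of the mixture bound.
    have hind : ∀ ω, A.indicator (X k') ω = A.indicator (X k) ω * ENNReal.ofReal ((√(1 + a ω))⁻¹ *
        Real.exp ((2 * b ω * η k ω + a ω * η k ω ^ 2 - b ω ^ 2) / (1 + a ω) / 2)) := by
      intro ω
      by_cases h : ω ∈ A <;> simp [h, hXk]
    calc _ = ∫⁻ ω, A.indicator (X k) ω * ENNReal.ofReal ((√(1 + a ω))⁻¹ *
        Real.exp ((2 * b ω * η k ω + a ω * η k ω ^ 2 - b ω ^ 2) / (1 + a ω) / 2)) ∂P :=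
          lintegral_congr hind
      _ ≤ _ := (hsub k).lintegral_mixture_le (𝓗.le k) (hη' k)
          ((hXm k).indicator hA) (measurable_bilin_inv (mα := 𝓗 k) (hVm k) (hx k) (hx k))
          (measurable_bilin_inv (mα := 𝓗 k) (hVm k) (hx k) (hSm k)) ha
  have hville := mul_measure_exists_le_one 𝓗 hXm h0 hstep (ENNReal.ofReal (1 / δ))
  have hsubset : {ω | ∃ k : Fin K, 2 * Real.log (1 / δ) + Real.log ((V k ω).det / l ^ d) <
      wnorm (V k ω)⁻¹ (S k ω) ^ 2} ⊆ {ω | ∃ k, ENNReal.ofReal (1 / δ) ≤ X k ω} := by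
    rintro ω ⟨k, hk⟩
    refine ⟨k, ENNReal.ofReal_le_ofReal ?_⟩
    have hdet := (hV k ω).det_pos
    have hD : 0 < (V k ω).det / l ^ d := by positivity
    rw [wnorm, Real.sq_sqrt (quadForm_nonneg (hV k ω).inv.posSemidef _)] at hk
    have hsq : √((V k ω).det / l ^ d) = Real.exp (Real.log ((V k ω).det / l ^ d) / 2) := by
      rw [← Real.log_sqrt hD.le, Real.exp_log (Real.sqrt_pos.2 hD)]
    rw [hsq, ← Real.exp_neg, ← Real.exp_add]
    calc 1 / δ = Real.exp (Real.log (1 / δ)) := (Real.exp_log (by positivity)).symm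
      _ ≤ _ := Real.exp_le_exp.2 (by linarith)
  calc _ ≤ P {ω | ∃ k, ENNReal.ofReal (1 / δ) ≤ X k ω} := measure_mono hsubset
    _ = ENNReal.ofReal δ *
        (ENNReal.ofReal (1 / δ) * P {ω | ∃ k, ENNReal.ofReal (1 / δ) ≤ X k ω}) := by
        rw [← mul_assoc, ← ENNReal.ofReal_mul hδ.le, mul_one_div_cancel hδ.ne',
          ENNReal.ofReal_one, one_mul]
    _ ≤ ENNReal.ofReal δ * 1 := by gcongr
    _ = _ := mul_one _

end SelfNormalized

/-! ### Conditional laws given by kernels, and Hoeffding's lemma -/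

section CondLaw

variable {Ω X Y : Type*} {m mΩ : MeasurableSpace Ω} [MeasurableSpace X] [mY : MeasurableSpace Y]

/-- Rectangles determine the joint law of `(ι, y)`. The separate space `Ω'` allows taking `Ω` itself
with the smaller `σ`-algebra `m` and `ι = id`. -/
lemma lintegral_prod_eq_of_setLIntegral {Ω' : Type*} [MeasurableSpace Ω'] (P : Measure Ω)
    [IsProbabilityMeasure P] (κ : Kernel Ω' Y) [IsMarkovKernel κ] {ι : Ω → Ω'} {y : Ω → Y}
    (hι : Measurable ι) (hy : Measurable y)
    (h : ∀ A B, MeasurableSet A → MeasurableSet B →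
      P (ι ⁻¹' A ∩ y ⁻¹' B) = ∫⁻ ω in ι ⁻¹' A, κ (ι ω) B ∂P)
    {f : Ω' × Y → ℝ≥0∞} (hf : Measurable f) :
    ∫⁻ ω, f (ι ω, y ω) ∂P = ∫⁻ ω, ∫⁻ u, f (ι ω, u) ∂κ (ι ω) ∂P := by
  have : IsProbabilityMeasure (P.map ι) := Measure.isProbabilityMeasure_map hι.aemeasurable
  have hmeas : P.map (fun ω => (ι ω, y ω)) = (P.map ι) ⊗ₘ κ := by
    refine Measure.ext_prod fun {A B} hA hB => ?_
    rw [Measure.map_apply (hι.prodMk hy) (hA.prod hB), Measure.compProd_apply_prod hA hB,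
      setLIntegral_map hA (κ.measurable_coe hB) hι]
    exact h A B hA hB
  rw [← lintegral_map hf (hι.prodMk hy), hmeas, Measure.lintegral_compProd hf,
    lintegral_map (Measurable.lintegral_kernel_prod_right' hf) hι]

/-- Freezing: integration against a conditional law. -/
lemma lintegral_eq_of_condLaw (P : Measure Ω) [IsProbabilityMeasure P]
    (hm : m ≤ mΩ) (κ : Kernel X Y) [IsMarkovKernel κ] {ξ : Ω → X} {y : Ω → Y}
    (hξ : Measurable[m] ξ) (hy : Measurable y)
    (hlaw : ∀ B, MeasurableSet B → P⟦y ⁻¹' B | m⟧ =ᵐ[P] fun ω => (κ (ξ ω)).real B)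
    {f : Ω × Y → ℝ≥0∞} (hf : Measurable[m.prod mY] f) :
    ∫⁻ ω, f (ω, y ω) ∂P = ∫⁻ ω, ∫⁻ u, f (ω, u) ∂κ (ξ ω) ∂P := by
  let κ' : @Kernel Ω Y m mY := Kernel.comap (mγ := m) κ ξ hξ
  have hκ' : @IsMarkovKernel Ω Y m mY κ' := Kernel.IsMarkovKernel.comap κ hξ
  refine @lintegral_prod_eq_of_setLIntegral Ω Y mΩ mY Ω m P _ κ' hκ' id y
    (measurable_id'' hm) hy ?_ f hf
  intro A B hA hB
  have hA' := hm A hA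
  have hB' := hy hB
  have hint : Integrable ((y ⁻¹' B).indicator fun _ => (1 : ℝ)) P :=
    (integrable_const 1).indicator hB'
  have h1 := setIntegral_condExp hm hint hA
  rw [setIntegral_congr_ae hA' ((hlaw B hB).mono fun ω h _ => h),
    setIntegral_indicator hB', setIntegral_const, smul_eq_mul, mul_one] at h1
  have hmeas : Measurable fun ω => (κ (ξ ω)) B :=
    (κ.measurable_coe hB).comp (hξ.mono hm le_rfl)
  change P (A ∩ y ⁻¹' B) = ∫⁻ ω in A, κ (ξ ω) B ∂P
  rw [← ENNReal.ofReal_toReal (measure_ne_top P (A ∩ y ⁻¹' B))]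
  change ENNReal.ofReal (P.real (A ∩ y ⁻¹' B)) = _
  rw [← h1]
  simp only [Measure.real]
  rw [integral_toReal hmeas.aemeasurable.restrict (by simp), ENNReal.ofReal_toReal]
  have hle : ∫⁻ ω in A, κ (ξ ω) B ∂P ≤ ∫⁻ _ in A, 1 ∂P :=
    setLIntegral_mono measurable_const fun ω _ => prob_le_one
  exact (hle.trans_lt (by simp)).ne

/-- Hoeffding's lemma for a variable with values in `[0, L]` whose conditional law is given by a
kernel. -/
lemma isCondSubgaussian_of_condLaw (P : Measure Ω) [IsProbabilityMeasure P]
    (hm : m ≤ mΩ) (κ : Kernel X Y) [IsMarkovKernel κ] {ξ : Ω → X}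
    {y : Ω → Y} (hξ : Measurable[m] ξ) (hy : Measurable y)
    (hlaw : ∀ B, MeasurableSet B → P⟦y ⁻¹' B | m⟧ =ᵐ[P] fun ω => (κ (ξ ω)).real B)
    {g : Ω × Y → ℝ} (hg : Measurable[m.prod mY] g) {L : ℝ} (hL : 0 < L)
    (hgL : ∀ ω, ∀ᵐ u ∂κ (ξ ω), g (ω, u) ∈ Set.Icc 0 L) {c : Ω → ℝ} (hc : Measurable[m] c)
    (hmean : ∀ ω, ∫ u, g (ω, u) ∂κ (ξ ω) = c ω) :
    IsCondSubgaussian m P fun ω => (g (ω, y ω) - c ω) / (L / 2) := by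
  intro f s hf hs
  have hfst : Measurable[m.prod mY, m] (Prod.fst : Ω × Y → Ω) := @measurable_fst _ _ m mY
  have hF : Measurable[m.prod mY] fun p : Ω × Y => f p.1 * ENNReal.ofReal
      (Real.exp (s p.1 * ((g p - c p.1) / (L / 2)) - s p.1 ^ 2 / 2)) := by
    have h1 := hs.comp hfst
    have h2 := hf.comp hfst
    have h3 := hc.comp hfst
    exact h2.mul (((h1.mul ((hg.sub h3).div_const _)).sub
      ((h1.pow_const 2).div_const 2)).exp.ennreal_ofReal)
  rw [lintegral_eq_of_condLaw P hm κ hξ hy hlaw hF]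
  refine lintegral_mono fun ω => ?_
  have hgω : Measurable fun u => g (ω, u) :=
    hg.comp (@measurable_prodMk_left _ _ m mY ω)
  change ∫⁻ u, f ω * ENNReal.ofReal (Real.exp (s ω * ((g (ω, u) - c ω) / (L / 2)) -
    s ω ^ 2 / 2)) ∂κ (ξ ω) ≤ f ω
  rw [lintegral_const_mul _ (((((hgω.sub_const _).div_const _).const_mul _).sub_const
    _).exp.ennreal_ofReal)]
  refine mul_le_of_le_one_right zero_le ?_
  have hoef := hasSubgaussianMGF_of_mem_Icc hgω.aemeasurable (hgL ω)
  -- Hoeffding's variance proxy for range `L` is `(L / 2) ^ 2`; this rescaling turns its bound into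
  -- `exp (s ^ 2 / 2)`, which cancels the compensator.
  set t := s ω / (L / 2) with ht
  have hpt : ∀ u, Real.exp (s ω * ((g (ω, u) - c ω) / (L / 2)) - s ω ^ 2 / 2) =
      Real.exp (-(s ω ^ 2 / 2)) *
        Real.exp (t * (g (ω, u) - ∫ u, g (ω, u) ∂κ (ξ ω))) := by
    intro u
    rw [← Real.exp_add, hmean]
    congr 1
    rw [ht]
    ring
  simp_rw [hpt]
  rw [← ofReal_integral_eq_lintegral_ofReal ((hoef.integrable_exp_mul t).const_mul _)
    (Filter.Eventually.of_forall fun u => by positivity), integral_const_mul, ← ENNReal.ofReal_one]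
  refine ENNReal.ofReal_le_ofReal ?_
  have hmgf := hoef.mgf_le t
  rw [mgf] at hmgf
  calc _ ≤ Real.exp (-(s ω ^ 2 / 2)) * Real.exp (((‖L - 0‖₊ / 2) ^ 2 : ℝ≥0) * t ^ 2 / 2) := by
        gcongr
    _ = 1 := by
        rw [← Real.exp_add, Real.exp_eq_one_iff, ht]
        simp only [sub_zero, NNReal.coe_pow, NNReal.coe_div, coe_nnnorm, Real.norm_eq_abs,
          abs_of_pos hL, NNReal.coe_ofNat]
        field_simp
        ring

end CondLaw

/-! ### The noise term of one regression -/

section Concentration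

variable {Ω : Type*} [mΩ : MeasurableSpace Ω] {K d : ℕ}

lemma wnorm_smul {c : ℝ} (hc : 0 ≤ c) (M : Matrix (Fin d) (Fin d) ℝ) (x : Vec d) :
    wnorm M (c • x) = c * wnorm M x := by
  rw [wnorm, wnorm, WithLp.ofLp_smul, Matrix.mulVec_smul, dotProduct_smul, smul_dotProduct,
    smul_smul, smul_eq_mul, Real.sqrt_mul (by positivity), Real.sqrt_mul_self hc]

/-- Uniform control of the noise term of least squares with bounded features. -/
theorem measure_exists_lt_wnorm_noise_le (P : Measure Ω) [IsProbabilityMeasure P]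
    (𝓗 : Filtration (Fin K) mΩ) {x : Fin K → Ω → Vec d} {y : Fin K → Ω → ℝ} {θ : Vec d}
    {L B : ℝ} (hL : 0 < L) (hx : ∀ k, Measurable[𝓗 k] (x k))
    (hy : ∀ j k, j < k → Measurable[𝓗 k] (y j)) (hy' : ∀ k, Measurable (y k))
    (hsub : ∀ k, IsCondSubgaussian (𝓗 k) P fun ω => (y k ω - inner ℝ (x k ω) θ) / (L / 2))
    (hB : ∀ k ω, ‖x k ω‖ ^ 2 ≤ B) {l δ : ℝ} (hl : 0 < l) (hδ : 0 < δ) :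
    P {ω | ∃ k : Fin K, L / 2 * √(2 * Real.log (1 / δ) + d * Real.log (1 + K * B / (d * l))) <
      wnorm (regGram (l • 1) (fun j => x j ω) k)⁻¹
        (∑ j ∈ Finset.Iio k, (y j ω - inner ℝ (x j ω) θ) • x j ω)} ≤ ENNReal.ofReal δ := by
  have hin : Continuous fun v : Vec d => inner ℝ v θ := by fun_prop
  have hxin : ∀ j k, j ≤ k → Measurable[𝓗 k] fun ω => inner ℝ (x j ω) θ := fun j k hjk =>
    hin.measurable.comp ((hx j).mono (𝓗.mono hjk) le_rfl)
  refine (measure_mono ?_).trans (measure_exists_lt_quadForm_le P 𝓗 hx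
    (η := fun k ω => (y k ω - inner ℝ (x k ω) θ) / (L / 2))
    (fun j k hjk => ((hy j k hjk).sub (hxin j k hjk.le)).div_const _)
    (fun k => ((hy' k).sub ((hxin k k le_rfl).mono (𝓗.le k) le_rfl)).div_const _) hsub hl hδ)
  rintro ω ⟨k, hk⟩
  refine ⟨k, ?_⟩
  have hS : ∑ j ∈ Finset.Iio k, (y j ω - inner ℝ (x j ω) θ) • x j ω = (L / 2) •
      ∑ j ∈ Finset.Iio k, ((y j ω - inner ℝ (x j ω) θ) / (L / 2)) • x j ω := by
    rw [Finset.smul_sum]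
    refine Finset.sum_congr rfl fun j _ => ?_
    rw [smul_smul, mul_div_cancel₀ _ (by positivity)]
  rw [hS, wnorm_smul (by positivity)] at hk
  -- After division by `L / 2` the weighted norm exceeds a square root, hence is positive, and
  -- squaring is valid even for a negative radicand.
  refine lt_of_le_of_lt ?_ ((Real.sqrt_lt' ((Real.sqrt_nonneg _).trans_lt
    (lt_of_mul_lt_mul_left hk (by positivity)))).1 (lt_of_mul_lt_mul_left hk (by positivity)))
  gcongr
  exact log_det_regGram_div_le hl fun j => hB j ω

/-- The share `α / H` of each step is the source of `log (H / α)` in both radii. -/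
lemma measure_iUnion_le_of_forall_le_div {H : ℕ} (P : Measure Ω) {E : Fin H → Set Ω} {α : ℝ}
    (hα : 0 ≤ α) (h : ∀ i, P (E i) ≤ ENNReal.ofReal (α / H)) :
    P (⋃ i, E i) ≤ ENNReal.ofReal α := by
  rcases Nat.eq_zero_or_pos H with rfl | hH
  · simp
  calc P (⋃ i, E i) ≤ ∑ i, P (E i) := measure_iUnion_fintype_le _ _
    _ ≤ ∑ _ : Fin H, ENNReal.ofReal (α / H) := Finset.sum_le_sum fun i _ => h i
    _ = ENNReal.ofReal α := by
      rw [← ENNReal.ofReal_sum_of_nonneg fun _ _ => by positivity]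
      congr 1
      simp
      field_simp

end Concentration

/-! ### Histories as filtrations -/

section EpisodeData

variable {Ω S A : Type*} [mS : MeasurableSpace S] [mA : MeasurableSpace A] {K H : ℕ}
  {T : Trajectories Ω S A K H}

lemma comap_state_le_episodeData (j : Fin K) (i : Fin (H + 1)) :
    mS.comap (T.state j i) ≤ episodeData T j :=
  (le_iSup (fun i => mS.comap (T.state j i)) i).trans (le_sup_left.trans le_sup_left)

lemma comap_action_le_episodeData (j : Fin K) (i : Fin H) :
    mA.comap (T.action j i) ≤ episodeData T j :=
  (le_iSup (fun i => mA.comap (T.action j i)) i).trans (le_sup_right.trans le_sup_left)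

lemma comap_reward_le_episodeData (j : Fin K) (i : Fin H) :
    (borel ℝ).comap (T.reward j i) ≤ episodeData T j :=
  (le_iSup (fun i => (borel ℝ).comap (T.reward j i)) i).trans le_sup_right

end EpisodeData

section History

variable {Ω S A : Type*} [mΩ : MeasurableSpace Ω] [mS : MeasurableSpace S]
  [mA : MeasurableSpace A] {K H : ℕ} {𝓤 : Filtration (Fin K) mΩ} {T : Trajectories Ω S A K H}

lemma startInfo_le_history (k : Fin K) (h : Fin H) : startInfo 𝓤 T k ≤ history 𝓤 T k h :=
  le_sup_left.trans (le_sup_left.trans le_sup_left)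

lemma measurable_state_history (k : Fin K) (h : Fin H) :
    Measurable[history 𝓤 T k h] (T.state k h.castSucc) :=
  measurable_iff_comap_le.2 <| le_trans
    (le_iSup₂_of_le (f := fun i (_ : i ≤ h.castSucc) => mS.comap (T.state k i)) _ le_rfl le_rfl)
    (le_sup_right.trans (le_sup_left.trans le_sup_left))

lemma measurable_action_history (k : Fin K) (h : Fin H) :
    Measurable[history 𝓤 T k h] (T.action k h) :=
  measurable_iff_comap_le.2 <| le_trans
    (le_iSup₂_of_le (f := fun i (_ : i ≤ h) => mA.comap (T.action k i)) _ le_rfl le_rfl)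
    (le_sup_right.trans le_sup_left)

lemma episodeData_le_startInfo {j k : Fin K} (hjk : j < k) :
    episodeData T j ≤ startInfo 𝓤 T k :=
  (le_iSup₂_of_le (f := fun j (_ : j < k) => episodeData T j) j hjk le_rfl).trans le_sup_right

lemma startInfo_mono : Monotone (startInfo 𝓤 T) := fun _ _ hjk =>
  sup_le_sup (𝓤.mono hjk) (iSup₂_le fun i hi =>
    le_iSup₂_of_le (f := fun i _ => episodeData T i) i (hi.trans_le hjk) le_rfl)

lemma history_le_startInfo {j k : Fin K} (hjk : j < k) (h : Fin H) :
    history 𝓤 T j h ≤ startInfo 𝓤 T k := by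
  have hE := episodeData_le_startInfo (𝓤 := 𝓤) (T := T) hjk
  refine sup_le (sup_le (sup_le (startInfo_mono hjk.le) ?_) ?_) ?_
  · exact iSup₂_le fun i _ => (comap_state_le_episodeData j i).trans hE
  · exact iSup₂_le fun i _ => (comap_action_le_episodeData j i).trans hE
  · exact iSup₂_le fun i _ => (comap_reward_le_episodeData j i).trans hE

/-- With the step `h` fixed, the episode plays the role of time: a whole episode, responses
included, is revealed before the next one starts. -/
lemma history_mono (h : Fin H) : Monotone fun k => history 𝓤 T k h := fun j k hjk => by
  rcases hjk.eq_or_lt with rfl | hlt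
  · exact le_rfl
  · exact (history_le_startInfo hlt h).trans (startInfo_le_history k h)

variable {M : EpisodicMDP S A H} {P : Measure Ω}

lemma IsInteraction.history_le (hT : IsInteraction M P 𝓤 T) (k : Fin K) (h : Fin H) :
    history 𝓤 T k h ≤ mΩ := by
  have hs := fun k i => (hT.measurable_state k i).comap_le
  have ha := fun k i => (hT.measurable_action k i).comap_le
  have hr := fun k i => (hT.measurable_reward k i).comap_le
  refine sup_le (sup_le (sup_le (sup_le (𝓤.le k) ?_) ?_) ?_) ?_
  · exact iSup₂_le fun j _ => sup_le (sup_le (iSup_le (hs j)) (iSup_le (ha j))) (iSup_le (hr j))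
  · exact iSup₂_le fun i _ => hs k i
  · exact iSup₂_le fun i _ => ha k i
  · exact iSup₂_le fun i _ => hr k i

/-- The information available at step `h`, as a filtration in the episode. -/
def IsInteraction.historyFiltration (hT : IsInteraction M P 𝓤 T) (h : Fin H) :
    Filtration (Fin K) mΩ where
  seq k := history 𝓤 T k h
  mono' := history_mono h
  le' k := hT.history_le k h

end History

/-! ### Features of the linear mixture model -/

section Features

variable {S A : Type*} [MeasurableSpace S] [MeasurableSpace A] {H d₁ d₂ : ℕ}
  {M : EpisodicMDP S A H} {μ : Measure S} {ψ : S → A → S → Vec d₁} {φ : S → A → Vec d₂}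
  {θp : Fin H → Vec d₁} {θr : Fin H → Vec d₂}

lemma measurable_valueFeature [SFinite μ] {Ω : Type*} {mΩ : MeasurableSpace Ω}
    (hψ : Measurable fun x : S × A × S => ψ x.1 x.2.1 x.2.2) {W : Ω → S → ℝ} {s : Ω → S}
    {a : Ω → A} (hW : Measurable fun p : Ω × S => W p.1 p.2) (hs : Measurable s)
    (ha : Measurable a) : Measurable fun ω => valueFeature μ ψ (W ω) (s ω) (a ω) := by
  have hm : Measurable fun p : Ω × S => W p.1 p.2 • ψ (s p.1) (a p.1) p.2 :=
    hW.smul (hψ.comp ((hs.comp measurable_fst).prodMk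
      ((ha.comp measurable_fst).prodMk measurable_snd)))
  exact hm.stronglyMeasurable.integral_prod_right'.measurable

/-- The inner product with `θp h` moves out of the integral against the density. Hence the
conditional mean of the response is linear in the feature, which is what the regression needs. -/
lemma IsLinearMixture.integral_trans (hM : IsLinearMixture M μ ψ φ θp θr) (h : Fin H) {W : S → ℝ}
    (hW : Measurable W) (hWH : ∀ s, W s ∈ Set.Icc (0 : ℝ) H) (s : S) (a : A) :
    ∫ u, W u ∂M.trans h (s, a) = inner ℝ (valueFeature μ ψ W s a) (θp h) := by
  have hψ : Measurable (ψ s a) := hM.measurable_ψ.comp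
    (measurable_const.prodMk (measurable_const.prodMk measurable_id))
  have hin : Continuous fun v : Vec d₁ => inner ℝ v (θp h) := by fun_prop
  have hint : Integrable (fun u => W u • ψ s a u) μ :=
    (hM.integrable_ψ s a).bdd_smul (H : ℝ) hW.aestronglyMeasurable
      (Filter.Eventually.of_forall fun u => by
        rw [Real.norm_of_nonneg (hWH u).1]
        exact (hWH u).2)
  have hdens : Measurable fun u => ENNReal.ofReal (inner ℝ (ψ s a u) (θp h)) :=
    (hin.measurable.comp hψ).ennreal_ofReal
  rw [hM.trans_eq, integral_withDensity_eq_integral_toReal_smul hdens (by simp), valueFeature,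
    real_inner_comm,
    ← integral_inner hint]
  refine integral_congr_ae (Filter.Eventually.of_forall fun u => ?_)
  simp only [ENNReal.toReal_ofReal (hM.density_nonneg h s a u), smul_eq_mul, inner_smul_right]
  rw [real_inner_comm, mul_comm]

end Features

/-! ### Noise bounds for the two regressions -/

section Interaction

lemma IsValueEstimate.measurable_transResponses {Ω S A : Type*} {m mΩ : MeasurableSpace Ω}
    [mS : MeasurableSpace S] [MeasurableSpace A] {K H : ℕ} {𝓤 : Filtration (Fin K) mΩ}
    {T : Trajectories Ω S A K H} {V : Fin K → Fin (H + 1) → Ω → S → ℝ}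
    (hV : IsValueEstimate 𝓤 T V) (j : Fin K) (h : Fin H) (hm : startInfo 𝓤 T j ≤ m)
    (hs : Measurable[m] (T.state j h.succ)) :
    Measurable[m] fun ω => transResponses T V h ω j := by
  have hid : Measurable[m, startInfo 𝓤 T j] fun ω : Ω => ω := measurable_id'' hm
  exact (hV.measurable j h.succ).comp (hid.prodMk hs)

variable {Ω S A : Type*} [mΩ : MeasurableSpace Ω] [mS : MeasurableSpace S]
  [mA : MeasurableSpace A] {K H d₁ d₂ : ℕ} {P : Measure Ω} [IsProbabilityMeasure P]
  {M : EpisodicMDP S A H} {μ : Measure S}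
  {ψ : S → A → S → Vec d₁} {φ : S → A → Vec d₂} {θp : Fin H → Vec d₁} {θr : Fin H → Vec d₂}
  {𝓤 : Filtration (Fin K) mΩ} {T : Trajectories Ω S A K H}
  {V : Fin K → Fin (H + 1) → Ω → S → ℝ} {l α : ℝ}

/-- The value function is determined before the episode, so only the next state is random given the
history, and the response has range `L = H`. -/
lemma measure_trans_noise_le [SFinite μ] (hM : IsLinearMixture M μ ψ φ θp θr)
    (hT : IsInteraction M P 𝓤 T) (hV : IsValueEstimate 𝓤 T V) (hl : 0 < l) (hα : 0 < α) (h : Fin H) :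
    P {ω | ∃ k : Fin K,
      H / 2 * √(2 * Real.log (H / α) + d₁ * Real.log (1 + K * (H : ℝ) ^ 2 / l)) <
      wnorm (regGram (l • 1) (transFeatures μ ψ T V h ω) k)⁻¹
        (∑ j ∈ Finset.Iio k, (transResponses T V h ω j -
          inner ℝ (transFeatures μ ψ T V h ω j) (θp h)) • transFeatures μ ψ T V h ω j)} ≤
      ENNReal.ofReal (α / H) := by
  have hH : (0 : ℝ) < H := by exact_mod_cast h.pos
  have hst := fun k => measurable_state_history (𝓤 := 𝓤) (T := T) k h
  have hac := fun k => measurable_action_history (𝓤 := 𝓤) (T := T) k h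
  have hVh : ∀ k, Measurable[(history 𝓤 T k h).prod mS]
      fun p : Ω × S => V k h.succ p.1 p.2 := fun k =>
    (hV.measurable k h.succ).mono (sup_le_sup
      (MeasurableSpace.comap_mono (startInfo_le_history k h)) le_rfl) le_rfl
  have hVω : ∀ k ω, Measurable (V k h.succ ω) := fun k ω =>
    (hV.measurable k h.succ).comp (@measurable_prodMk_left _ _ (startInfo 𝓤 T k) mS ω)
  have hx : ∀ k, Measurable[history 𝓤 T k h] fun ω => transFeatures μ ψ T V h ω k := fun k =>
    measurable_valueFeature (mΩ := history 𝓤 T k h) hM.measurable_ψ (hVh k) (hst k) (hac k)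
  have hy : ∀ j k, j < k → Measurable[history 𝓤 T k h] fun ω => transResponses T V h ω j :=
    fun j k hjk => hV.measurable_transResponses j h
      ((startInfo_mono hjk.le).trans (startInfo_le_history k h))
      (measurable_iff_comap_le.2 ((comap_state_le_episodeData j _).trans
        ((episodeData_le_startInfo hjk).trans (startInfo_le_history k h))))
  have hy' : ∀ k, Measurable fun ω => transResponses T V h ω k := fun k =>
    hV.measurable_transResponses k h ((startInfo_le_history k h).trans (hT.history_le k h))
      (hT.measurable_state k _)
  have hin : Continuous fun v : Vec d₁ => inner ℝ v (θp h) := by fun_prop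
  have hsub : ∀ k, IsCondSubgaussian (history 𝓤 T k h) P fun ω =>
      (transResponses T V h ω k - inner ℝ (transFeatures μ ψ T V h ω k) (θp h)) / (H / 2) := by
    intro k
    have := M.markov_trans h
    exact isCondSubgaussian_of_condLaw P (hT.history_le k h) (M.trans h)
      (ξ := fun ω => (T.state k h.castSucc ω, T.action k h ω)) ((hst k).prodMk (hac k))
      (hT.measurable_state k h.succ) (hT.state_law k h) (hVh k) hH
      (fun ω => Filter.Eventually.of_forall fun u => hV.mem_Icc k h.succ ω u)
      (hin.measurable.comp (hx k))
      (fun ω => hM.integral_trans h (hVω k ω) (hV.mem_Icc k h.succ ω) _ _)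
  have hB : ∀ k ω, ‖transFeatures μ ψ T V h ω k‖ ^ 2 ≤ d₁ * (H : ℝ) ^ 2 := by
    intro k ω
    rw [← Real.sq_sqrt (Nat.cast_nonneg (α := ℝ) d₁), ← mul_pow]
    gcongr
    exact hM.norm_valueFeature _ (hVω k ω) (hV.mem_Icc k h.succ ω) _ _
  have hfin := measure_exists_lt_wnorm_noise_le P (hT.historyFiltration h) hH hx hy hy' hsub hB hl
    (div_pos hα hH)
  -- The `d₁` in the squared feature bound `d₁ H²` cancels the dimension coming from the trace; for
  -- `d₁ = 0` both sides vanish.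
  have heq : (d₁ : ℝ) * Real.log (1 + K * (d₁ * (H : ℝ) ^ 2) / (d₁ * l)) =
      d₁ * Real.log (1 + K * (H : ℝ) ^ 2 / l) := by
    rcases Nat.eq_zero_or_pos d₁ with rfl | hd
    · simp
    · congr 3
      field_simp
  rwa [one_div_div, heq] at hfin

lemma measure_reward_noise_le (hM : IsLinearMixture M μ ψ φ θp θr) (hT : IsInteraction M P 𝓤 T)
    (hl : 0 < l) (hα : 0 < α) (h : Fin H) :
    P {ω | ∃ k : Fin K,
      1 / 2 * √(2 * Real.log (H / α) + d₂ * Real.log (1 + K / (d₂ * l))) <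
      wnorm (regGram (l • 1) (rewardFeatures φ T h ω) k)⁻¹
        (∑ j ∈ Finset.Iio k, (rewardResponses T h ω j -
          inner ℝ (rewardFeatures φ T h ω j) (θr h)) • rewardFeatures φ T h ω j)} ≤
      ENNReal.ofReal (α / H) := by
  have hH : (0 : ℝ) < H := by exact_mod_cast h.pos
  have hξ : ∀ k, Measurable[history 𝓤 T k h] fun ω => (T.state k h.castSucc ω, T.action k h ω) :=
    fun k => (measurable_state_history k h).prodMk (measurable_action_history k h)
  have hx : ∀ k, Measurable[history 𝓤 T k h] fun ω => rewardFeatures φ T h ω k := fun k =>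
    hM.measurable_φ.comp (hξ k)
  have hy : ∀ j k, j < k → Measurable[history 𝓤 T k h] fun ω => rewardResponses T h ω j :=
    fun j k hjk => measurable_iff_comap_le.2 ((comap_reward_le_episodeData j _).trans
        ((episodeData_le_startInfo hjk).trans (startInfo_le_history k h)))
  have hin : Continuous fun v : Vec d₂ => inner ℝ v (θr h) := by fun_prop
  have hsub : ∀ k, IsCondSubgaussian (history 𝓤 T k h) P fun ω =>
      (rewardResponses T h ω k - inner ℝ (rewardFeatures φ T h ω k) (θr h)) / (1 / 2) := by
    intro k
    have := M.markov_reward h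
    exact isCondSubgaussian_of_condLaw P (hT.history_le k h) (M.reward h) (hξ k)
      (hT.measurable_reward k h) (hT.reward_law k h) (g := Prod.snd)
      (@measurable_snd _ _ (history 𝓤 T k h) _) one_pos
      (fun ω => mem_ae_iff.2 (M.reward_supp h _)) (hin.measurable.comp (hx k))
      (fun ω => hM.reward_eq h _ _)
  have hB : ∀ k ω, ‖rewardFeatures φ T h ω k‖ ^ 2 ≤ 1 := fun k ω =>
    pow_le_one₀ (norm_nonneg _) (hM.norm_φ _ _)
  have hfin := measure_exists_lt_wnorm_noise_le P (hT.historyFiltration h) one_pos hx hy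
    (fun k => hT.measurable_reward k h) hsub hB hl (div_pos hα hH)
  rwa [one_div_div, mul_one] at hfin

end Interaction

end LinMix

/-! ### Assembling the events -/

open LinMix
theorem mainTheorem5 {Ω S A : Type*} [mΩ : MeasurableSpace Ω] [MeasurableSpace S]
    [MeasurableSpace A] {K H d₁ d₂ : ℕ}
    (P : Measure Ω) [IsProbabilityMeasure P]
    (M : EpisodicMDP S A H) (μ : Measure S) [SigmaFinite μ]
    (ψ : S → A → S → Vec d₁) (φ : S → A → Vec d₂)
    (θp : Fin H → Vec d₁) (θr : Fin H → Vec d₂)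
    (hM : IsLinearMixture M μ ψ φ θp θr)
    (𝓤 : Filtration (Fin K) mΩ) (T : Trajectories Ω S A K H) (hT : IsInteraction M P 𝓤 T)
    (V : Fin K → Fin (H + 1) → Ω → S → ℝ) (hV : IsValueEstimate 𝓤 T V)
    (Zp : Fin K → Fin H → Ω → Matrix (Fin d₁) (Fin d₁) ℝ) (zp : Fin K → Fin H → Ω → Vec d₁)
    (Zr : Fin K → Fin H → Ω → Matrix (Fin d₂) (Fin d₂) ℝ) (zr : Fin K → Fin H → Ω → Vec d₂)
    (hZp : ∀ k h i j, Measurable fun ω => Zp k h ω i j)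
    (hzp : ∀ k h, Measurable (zp k h))
    (hZr : ∀ k h i j, Measurable fun ω => Zr k h ω i j)
    (hzr : ∀ k h, Measurable (zr k h))
    (α : ℝ) (hα : α ∈ Set.Ioc (0 : ℝ) 1)
    (lmaxp lminp νp lmaxr lminr νr : ℝ) (hlp : 0 < lminp) (hlr : 0 < lminr)
    (hreg : 1 - α ≤ P.real (regularEvent Zp zp lmaxp lminp νp ∩
      regularEvent Zr zr lmaxr lminr νr)) :
    1 - 3 * α ≤ P.real {ω | ∀ k h,
      (regGram (Zp k h ω) (transFeatures μ ψ T V h ω) k).PosDef ∧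
      (regGram (Zr k h ω) (rewardFeatures φ T h ω) k).PosDef ∧
      wnorm (regGram (Zp k h ω) (transFeatures μ ψ T V h ω) k)
          (θp h - regEstimator (Zp k h ω) (zp k h ω) (transFeatures μ ψ T V h ω)
            (transResponses T V h ω) k)
        ≤ betaP K H d₁ lmaxp lminp νp α ∧
      wnorm (regGram (Zr k h ω) (rewardFeatures φ T h ω) k)
          (θr h - regEstimator (Zr k h ω) (zr k h ω) (rewardFeatures φ T h ω)
            (rewardResponses T h ω) k)
        ≤ betaR K H d₂ lmaxr lminr νr α} := by
  have hα0 : 0 < α := hα.1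
  have hEp := measure_iUnion_le_of_forall_le_div P hα0.le
    fun h => measure_trans_noise_le hM hT hV hlp hα0 h
  have hEr := measure_iUnion_le_of_forall_le_div P hα0.le
    fun h => measure_reward_noise_le hM hT hlr hα0 h
  generalize hEpdef : (⋃ _, _ : Set Ω) = Ep at hEp
  generalize hErdef : (⋃ _, _ : Set Ω) = Er at hEr
  have hEp' : P.real Ep ≤ α := ENNReal.toReal_le_of_le_ofReal hα0.le hEp
  have hEr' : P.real Er ≤ α := ENNReal.toReal_le_of_le_ofReal hα0.le hEr
  set G := {ω | ∀ k h, _} with hG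
  -- Off the two noise events the pathwise bound applies at every regular outcome, so the failure
  -- probabilities add up to `3 * α`.
  have hsub : regularEvent Zp zp lmaxp lminp νp ∩ regularEvent Zr zr lmaxr lminr νr ⊆
      G ∪ (Ep ∪ Er) := by
    rintro ω ⟨hp, hr⟩
    by_cases hE : ω ∈ Ep ∪ Er
    · exact Or.inr hE
    refine Or.inl fun k h => ?_
    obtain ⟨hp1, hp2, hp3, hp4⟩ := hp k h
    obtain ⟨hr1, hr2, hr3, hr4⟩ := hr k h
    simp only [← hEpdef, ← hErdef, Set.mem_union, Set.mem_iUnion, Set.mem_ofPred_eq, not_or,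
      not_exists, not_lt] at hE
    exact ⟨regGram_posDef hp1 _ k, regGram_posDef hr1 _ k,
      wnorm_sub_regEstimator_le hlp hp1 hp2 hp3 hp4 (hM.norm_θp h) (hE.1 h k),
      wnorm_sub_regEstimator_le hlr hr1 hr2 hr3 hr4 (hM.norm_θr h) (hE.2 h k)⟩
  have h1 : P.real _ ≤ _ := measureReal_mono hsub
  have h2 := measureReal_union_le (μ := P) G (Ep ∪ Er)
  have h3 := measureReal_union_le (μ := P) Ep Er
  linarith
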